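/- Let $K$ be a field, let $E=\{1,\dots,n\}$ (or any finite set), and let $\mathbf r=(r_1,\dots,r_s)$ be a sequence of non-negative integers. Fix a field automorphism $\tau$ of $K$ with $\tau^2=\mathrm{id}$ (for instance $\tau=\mathrm{id}$). A *Grassmann–Plücker function of rank $r$ on $E$ over $K$* is a function $\varphi:E^r\to K$ that is not identically zero, is alternating (it changes sign when two arguments are exchanged and vanishes when two arguments are equal), and satisfies $$\sum_{k=1}^{r+1}(-1)^k\,\varphi(y_1,\dots,\widehat{y_k},\dots,y_{r+1})\,\varphi(y_k,x_1,\dots,x_{r-1})=0$$ for all $x_1,\dots,x_{r-1},y_1,\dots,y_{r+1}\in E$ (no condition if $r=0$). A *$K$-matroid of rank $r$ on $E$* is a class $M=[\varphi]$ of such functions up to multiplication by elements of $K^\times$. The sets $\{x_1,\dots,x_r\}$ with $\varphi(x_1,\dots,x_r)\neq 0$ are the bases of the underlying matroid $\underline M$. For a circuit $C$ of $\underline M$, an element $y_0\in C$ and a basis $\{y_1,\dots,y_r\}\supseteq C-y_0$, let $X_C\in K^E$ be the vector with $X_C(y_i)=(-1)^i\varphi(y_0,\dots,\widehat{y_i},\dots,y_r)$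 for $0\le i\le r$ and $X_C(y)=0$ for all other $y$. The set $\mathcal C(M)$ of $K$-circuits of $M$ consists of all vectors $aX_C$ with $a\in K^\times$ and $C$ a circuit of $\underline M$. The *covector set* of $M$ is $$\mathcal V^*(M)=\Big\{X\in K^E \;\Big|\; \sum_{e\in E}X(e)\,\tau(Y(e))=0\text{ for all }Y\in\mathcal C(M)\Big\}.$$ A *flag $K$-matroid of rank $\mathbf r$ on $E$* is a sequence $\mathbf M=(M_1,\dots,M_s)$ of $K$-matroids $M_i=[\varphi_i]$ of rank $r_i$ on $E$ such that $$\sum_{k=1}^{r_j+1}(-1)^k\,\varphi_j(y_1,\dots,\widehat{y_k},\dots,y_{r_j+1})\,\varphi_i(y_k,x_1,\dots,x_{r_i-1})=0$$ for all $1\le i<j\le s$ and all $x_1,\dots,x_{r_i-1},y_1,\dots,y_{r_j+1}\in E$ (no condition if $r_i=0$). **Proposition.** For every flag $K$-matroid $\mathbf M=(M_1,\dots,M_s)$ of rank $\mathbf r$ on $E$, the covector sets form a chain $\mathcal V^*(M_1)\subseteq\dots\subseteq\mathcal V^*(M_s)$ of linear subspaces of $K^E$ with $\dim\mathcal V^*(M_i)=r_i$,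 and the map $\mathbf M\mapsto(\mathcal V^*(M_1),\dots,\mathcal V^*(M_s))$ is a bijection between the set of flag $K$-matroids of rank $\mathbf r$ on $E$ and the set of flags $V_1\subseteq\dots\subseteq V_s$ of linear subspaces of $K^E$ with $\dim V_i=r_i$ for all $i$. -/

import Mathlib

/-! ### Tracts -/

/-- A tract: a commutative pointed monoid `F` in which every non-zero element is invertible
(and `0 ≠ 1`), together with a nullset in the group semiring `ℕ[Fˣ]`. -/
class Tract (F : Type*) [CommGroupWithZero F] where
  nullset : Set (MonoidAlgebra ℕ Fˣ)
  zero_mem : (0 : MonoidAlgebra ℕ Fˣ) ∈ nullset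
  one_notMem : (1 : MonoidAlgebra ℕ Fˣ) ∉ nullset
  existsUnique_eps : ∃! ε : Fˣ, 1 + MonoidAlgebra.of ℕ Fˣ ε ∈ nullset
  smul_mem : ∀ (u : Fˣ), ∀ x ∈ nullset, MonoidAlgebra.of ℕ Fˣ u * x ∈ nullset

namespace Tract

variable {F : Type*} [CommGroupWithZero F]

/-- An element of `F`, seen as an element of `ℕ[Fˣ]`: a unit is sent to the corresponding
generator, and `0` is sent to `0`. -/
noncomputable def toSemiring (a : F) : MonoidAlgebra ℕ Fˣ :=
  open Classical in
  if h : a = 0 then 0 else MonoidAlgebra.of ℕ Fˣ (Units.mk0 a h)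

variable [Tract F]

/-- The unique element `ε` with `1 + ε ∈ N_F`. -/
noncomputable def eps (F : Type*) [CommGroupWithZero F] [Tract F] : Fˣ :=
  (Tract.existsUnique_eps (F := F)).choose

/-- A formal finite sum of elements of `F` belongs to the nullset. -/
def IsNull {ι : Type*} [Fintype ι] (a : ι → F) : Prop :=
  ∑ i, toSemiring (a i) ∈ Tract.nullset (F := F)

/-- A multiplicative map preserving `0` and `1` is a morphism of tracts if it maps null sums
to null sums. -/
def IsHom {F' : Type*} [CommGroupWithZero F'] [Tract F'] (f : F →*₀ F') : Prop :=
  ∀ x ∈ Tract.nullset (F := F),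
    MonoidAlgebra.mapDomain (Units.map (f : F →* F')) x ∈ Tract.nullset (F := F')

/-- An involution of the tract `F`. -/
def IsInvolution (τ : F →*₀ F) : Prop :=
  IsHom τ ∧ ∀ a, τ (τ a) = a

theorem not_null_unit (u : Fˣ) : MonoidAlgebra.of ℕ Fˣ u ∉ Tract.nullset (F := F) := by
  intro h
  have := Tract.smul_mem u⁻¹ _ h
  rw [← map_mul, inv_mul_cancel, map_one] at this
  exact Tract.one_notMem this

end Tract

/-- The evaluation `ℕ[Kˣ] → K`, `∑ aᵢ ↦ ∑ aᵢ`. -/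
noncomputable def fieldEval (K : Type*) [Field K] : MonoidAlgebra ℕ Kˣ →ₐ[ℕ] K :=
  MonoidAlgebra.lift ℕ K Kˣ (Units.coeHom K)

/-- A field, considered as a tract: the null sums are the formal sums of units whose value
in `K` is zero. -/
noncomputable instance fieldTract (K : Type*) [Field K] : Tract K where
  nullset := {x | fieldEval K x = 0}
  zero_mem := by simp
  one_notMem := by simp
  existsUnique_eps := by
    refine ⟨-1, by simp [fieldEval], ?_⟩
    intro u hu
    simp only [fieldEval, Set.mem_ofPred_eq, map_add, map_one, MonoidAlgebra.lift_of,
      Units.coeHom_apply] at hu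
    ext
    simpa using (neg_eq_of_add_eq_zero_right hu).symm
  smul_mem := by
    intro u x hx
    simp only [Set.mem_ofPred_eq] at hx ⊢
    rw [map_mul, hx, mul_zero]

/-! ### Matroids over tracts -/

section Matroids

open Tract

variable {F : Type*} [CommGroupWithZero F] [Tract F] {E : Type*}

/-- The Plücker flag relations between `ν : E ^ w → F` and `μ : E ^ r → F`: for all
`y₁, …, y_{w+1}, x₁, …, x_{r-1}` in `E`, the formal sum over `k` of
`ε ^ k * ν (y₁, …, ŷ_k, …, y_{w+1}) * μ (y_k, x₁, …, x_{r-1})` is null. The index `k` is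
shifted by one since `Fin (w + 1)` starts at `0`. For `r = 0` there is no such tuple `x`, and
hence no relation. -/
def PluckerFlagRelations {w r : ℕ} (ν : (Fin w → E) → F) (μ : (Fin r → E) → F) : Prop :=
  ∀ (m : ℕ) (hr : r = m + 1) (y : Fin (w + 1) → E) (x : Fin m → E),
    IsNull fun k : Fin (w + 1) =>
      (eps F : F) ^ ((k : ℕ) + 1) * ν (y ∘ k.succAbove) *
        μ ((Fin.cons (y k) x : Fin (m + 1) → E) ∘ Fin.cast hr)

/-- Grassmann–Plücker functions of rank `r` on `E` with coefficients in `F`. -/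
structure GPFunction (F : Type*) [CommGroupWithZero F] [Tract F] (E : Type*) (r : ℕ) where
  toFun : (Fin r → E) → F
  exists_ne_zero : ∃ x, toFun x ≠ 0
  swap : ∀ (x : Fin r → E) (i j : Fin r), i ≠ j →
    toFun (x ∘ Equiv.swap i j) = eps F * toFun x
  eq_zero : ∀ (x : Fin r → E) (i j : Fin r), i ≠ j → x i = x j → toFun x = 0
  plucker : PluckerFlagRelations toFun toFun

namespace GPFunction

variable {r : ℕ}

theorem injective_of_ne_zero (φ : GPFunction F E r) {x : Fin r → E} (h : φ.toFun x ≠ 0) :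
    Function.Injective x := by
  intro i j hij
  by_contra hne
  exact h (φ.eq_zero x i j hne hij)

/-- The bases of the underlying matroid: sets `{x₁, …, x_r}` with `φ (x₁, …, x_r) ≠ 0`. -/
def IsBase (φ : GPFunction F E r) (B : Set E) : Prop :=
  ∃ x : Fin r → E, φ.toFun x ≠ 0 ∧ B = Set.range x

theorem exchange (φ : GPFunction F E r) : Matroid.ExchangeProperty φ.IsBase := by
  rintro _ _ ⟨x, hx, rfl⟩ ⟨z, hz, rfl⟩ e ⟨⟨i, rfl⟩, hez⟩
  obtain _ | m := r
  · exact i.elim0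
  -- move the element to be exchanged to the first position
  obtain ⟨x', hx', hrange, h0⟩ : ∃ x' : Fin (m + 1) → E, φ.toFun x' ≠ 0 ∧
      Set.range x' = Set.range x ∧ x' 0 = x i := by
    by_cases hi : 0 = i
    · exact ⟨x, hx, rfl, by rw [hi]⟩
    · refine ⟨x ∘ Equiv.swap 0 i, ?_, ?_, ?_⟩
      · rw [φ.swap x 0 i hi]
        exact mul_ne_zero (Units.ne_zero _) hx
      · exact (Equiv.swap 0 i).surjective.range_comp x
      · simp
  rw [← hrange, ← h0]
  rw [← h0] at hez
  have hinj := φ.injective_of_ne_zero hx'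
  have hex : ∃ k : Fin (m + 1), φ.toFun (Fin.cons (z k) (Fin.tail x')) ≠ 0 := by
    by_contra hcon
    push Not at hcon
    have hP := φ.plucker m rfl (Fin.cons (x' 0) z) (Fin.tail x')
    unfold IsNull at hP
    rw [Fin.sum_univ_succ, Finset.sum_eq_zero, add_zero] at hP
    · have hne : (eps F : F) ^ (((0 : Fin (m + 1 + 1)) : ℕ) + 1) *
          φ.toFun ((Fin.cons (x' 0) z : Fin (m + 1 + 1) → E) ∘ (0 : Fin (m + 2)).succAbove) *
          φ.toFun ((Fin.cons ((Fin.cons (x' 0) z : Fin (m + 1 + 1) → E) 0) (Fin.tail x') :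
            Fin (m + 1) → E) ∘ Fin.cast rfl) ≠ 0 := by
        refine mul_ne_zero (mul_ne_zero (pow_ne_zero _ (Units.ne_zero _)) ?_) ?_
        · have : (Fin.cons (x' 0) z : Fin (m + 1 + 1) → E) ∘ (0 : Fin (m + 2)).succAbove = z := by
            funext j; simp
          rwa [this]
        · have : (Fin.cons ((Fin.cons (x' 0) z : Fin (m + 1 + 1) → E) 0) (Fin.tail x') :
            Fin (m + 1) → E) ∘ Fin.cast rfl = x' := by
            funext j; simp [Fin.cons_self_tail]
          rwa [this]
      rw [toSemiring, dif_neg hne] at hP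
      exact not_null_unit _ hP
    · intro k _
      have : φ.toFun ((Fin.cons ((Fin.cons (x' 0) z : Fin (m + 1 + 1) → E) k.succ) (Fin.tail x') :
          Fin (m + 1) → E) ∘ Fin.cast rfl) = 0 := by
        simpa using hcon k
      beta_reduce
      rw [this, mul_zero, toSemiring, dif_pos rfl]
  obtain ⟨k, hk⟩ := hex
  have hkinj := φ.injective_of_ne_zero hk
  have htail : ∀ j : Fin m, z k ≠ x' j.succ := by
    intro j hj
    have : (0 : Fin (m + 1)) = j.succ := hkinj (by simpa [Fin.tail] using hj)
    exact (Fin.succ_ne_zero j) this.symm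
  refine ⟨z k, ⟨⟨k, rfl⟩, ?_⟩, _, hk, ?_⟩
  · rintro ⟨j, hj⟩
    induction j using Fin.cases with
    | zero => exact hez ⟨k, hj.symm⟩
    | succ j => exact htail j hj.symm
  · ext b
    simp only [Set.mem_insert_iff, Set.mem_sdiff, Set.mem_range, Set.mem_singleton_iff,
      Fin.exists_fin_succ, Fin.cons_zero, Fin.cons_succ, Fin.tail]
    constructor
    · rintro (rfl | ⟨h | ⟨j, rfl⟩, hb⟩)
      · exact Or.inl rfl
      · exact absurd h.symm hb
      · exact Or.inr ⟨j, rfl⟩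
    · rintro (rfl | ⟨j, rfl⟩)
      · exact Or.inl rfl
      · refine Or.inr ⟨Or.inr ⟨j, rfl⟩, fun h => ?_⟩
        exact Fin.succ_ne_zero j (hinj h)

/-- The underlying matroid, given by its bases. -/
def underlying [Finite E] (φ : GPFunction F E r) : Matroid E :=
  Matroid.ofIsBaseOfFinite (Set.finite_univ (α := E)) φ.IsBase
    (let ⟨x, hx⟩ := φ.exists_ne_zero; ⟨_, x, hx, rfl⟩) φ.exchange (fun _ _ => Set.subset_univ _)

/-- For a tuple `y = (y₀, …, y_r)` of pairwise distinct elements, the vector in `F ^ E` with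
entries `ε ^ i * φ (y₀, …, ŷ_i, …, y_r)` at `y_i`, and `0` away from the `y_i`. -/
noncomputable def circuitVector (φ : GPFunction F E r) (y : Fin (r + 1) → E) : E → F :=
  Function.extend y (fun i => (eps F : F) ^ (i : ℕ) * φ.toFun (y ∘ i.succAbove)) 0

/-- The `F`-circuits `a • X_C`, where `a` is a unit, `C` is a circuit of the underlying matroid,
and `X_C` is computed from some `y₀ ∈ C` and some basis `{y₁, …, y_r}` containing `C - y₀`. -/
def circuits [Finite E] (φ : GPFunction F E r) : Set (E → F) :=
  {X | ∃ (C : Set E) (y : Fin (r + 1) → E) (a : Fˣ),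
    φ.underlying.IsCircuit C ∧ y 0 ∈ C ∧ φ.toFun (Fin.tail y) ≠ 0 ∧
    C \ {y 0} ⊆ Set.range (Fin.tail y) ∧ X = fun e => (a : F) * φ.circuitVector y e}

/-- Two Grassmann–Plücker functions are equivalent if they differ by a unit. -/
instance setoid (F : Type*) [CommGroupWithZero F] [Tract F] (E : Type*) (r : ℕ) :
    Setoid (GPFunction F E r) where
  r φ ψ := ∃ a : Fˣ, ∀ x, φ.toFun x = a * ψ.toFun x
  iseqv :=
    { refl := fun φ => ⟨1, by simp⟩
      symm := by
        rintro φ ψ ⟨a, h⟩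
        exact ⟨a⁻¹, fun x => by simp [h x]⟩
      trans := by
        rintro φ ψ χ ⟨a, h⟩ ⟨b, h'⟩
        exact ⟨a * b, fun x => by rw [h x, h' x, Units.val_mul, mul_assoc]⟩ }

end GPFunction

/-- `F`-matroids of rank `r` on `E`. -/
def FMatroid (F : Type*) [CommGroupWithZero F] [Tract F] (E : Type*) (r : ℕ) : Type _ :=
  Quotient (GPFunction.setoid F E r)

/-- The inner product of `X` and `Y` is null, with respect to the involution `τ`. -/
def Tract.Orthogonal [Fintype E] (τ : F →*₀ F) (X Y : E → F) : Prop :=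
  IsNull fun e => X e * τ (Y e)

namespace FMatroid

/-- The Grassmann–Plücker function `φ` represents the `F`-matroid `M`. -/
def Represents {r : ℕ} (φ : GPFunction F E r) (M : FMatroid F E r) : Prop :=
  Quotient.mk (GPFunction.setoid F E r) φ = M

/-- The `F`-circuits of `M`. -/
def circuits [Finite E] {r : ℕ} (M : FMatroid F E r) : Set (E → F) :=
  {X | ∃ φ, Represents φ M ∧ X ∈ φ.circuits}

/-- The `F`-covectors of `M`, that is, the vectors orthogonal to all `F`-circuits of `M`. -/
def covectors [Fintype E] (τ : F →*₀ F) {r : ℕ} (M : FMatroid F E r) : Set (E → F) :=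
  {X | ∀ Y ∈ M.circuits, Orthogonal τ X Y}

/-- `M` is a quotient of `N`: every choice of representing Grassmann–Plücker functions satisfies
the Plücker flag relations. -/
def IsQuotientOf {r w : ℕ} (M : FMatroid F E r) (N : FMatroid F E w) : Prop :=
  ∀ (μ : GPFunction F E r) (ν : GPFunction F E w), Represents μ M → Represents ν N →
    PluckerFlagRelations ν.toFun μ.toFun

end FMatroid

/-- Flag `F`-matroids of rank `(r₁, …, r_s)` on `E`. -/
def FlagMatroid (F : Type*) [CommGroupWithZero F] [Tract F] (E : Type*) {s : ℕ}
    (r : Fin s → ℕ) : Type _ :=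
  {M : (i : Fin s) → FMatroid F E (r i) // ∀ i j, i < j → (M i).IsQuotientOf (M j)}

/-- Flags `V₁ ⊆ … ⊆ V_s` of linear subspaces of `K ^ E` with `dim V_i = r_i`. -/
def LinearFlag (K : Type*) [Field K] (E : Type*) {s : ℕ} (r : Fin s → ℕ) : Type _ :=
  {V : Fin s → Submodule K (E → K) // Monotone V ∧ ∀ i, Module.finrank K (V i) = r i}

end Matroids

/-! ### Fields as tracts -/

namespace Tract

variable {K : Type*} [Field K]

/-! To a Grassmann–Plücker function φ attach the space L(φ) of vectors v with ∑ ± φ(y₀, …, ŷ_k, …,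
y_r) v(y_k) = 0 for all y. The Plücker relations say exactly that every slice e ↦ φ(x₁, …, e, …,
x_r) lies in L(φ). Fix a tuple b with φ(b) ≠ 0. The relation for (e, b) recovers v(e) from the
restriction of v to b, while the slices at b, divided by φ(b), are dual to the points of b. So L(φ)
restricts isomorphically onto K^r; it has dimension r and is spanned by slices
(`finrank_relationSpace`, `relationSpace_eq_span`). The flag relations therefore mean inclusion of
these spaces (`pluckerFlagRelations_iff_le`).

L(φ) determines φ up to a unit (`equiv_of_relationSpace_eq`), and every r-dimensional space arises
from the maximal minors of a basis (`exists_gpFunction_relationSpace_eq`). Finally, X is a covector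
iff τ ∘ X lies in L(φ) (`orthogonal_circuits_iff`), and this twist by τ preserves inclusions and
dimensions and is invertible. -/

@[simp] theorem fieldEval_toSemiring (a : K) : fieldEval K (toSemiring a) = a := by
  unfold toSemiring
  split_ifs with h
  · simp [h]
  · simp [fieldEval]

theorem isNull_iff_sum_eq_zero {ι : Type*} [Fintype ι] (a : ι → K) :
    IsNull a ↔ ∑ i, a i = 0 := by
  change fieldEval K (∑ i, toSemiring (a i)) = 0 ↔ _
  simp

@[simp] theorem coe_eps_field : ((eps K : Kˣ) : K) = -1 := by
  have h : fieldEval K (1 + MonoidAlgebra.of ℕ Kˣ (eps K)) = 0 :=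
    (Tract.existsUnique_eps (F := K)).choose_spec.1
  rw [map_add, map_one] at h
  have h' : fieldEval K (MonoidAlgebra.of ℕ Kˣ (eps K)) = (eps K : K) := by simp [fieldEval]
  rw [h'] at h
  exact eq_neg_of_add_eq_zero_right h

theorem mapDomain_toSemiring (f : K →*₀ K) (a : K) :
    MonoidAlgebra.mapDomain (Units.map (f : K →* K)) (toSemiring a) = toSemiring (f a) := by
  unfold toSemiring
  by_cases h : a = 0
  · simp [h]
  · have h' : f a ≠ 0 := (map_ne_zero f).2 h
    rw [dif_neg h, dif_neg h', MonoidAlgebra.of_apply, MonoidAlgebra.of_apply,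
      MonoidAlgebra.mapDomain_single]
    congr 1
    ext
    simp

theorem IsHom.map_add {f : K →*₀ K} (hf : IsHom f) (a b : K) : f (a + b) = f a + f b := by
  have key : ∀ c d e : K, c + d + e = 0 → f c + f d + f e = 0 := by
    intro c d e h
    have := hf (toSemiring c + toSemiring d + toSemiring e) (by
      change fieldEval K _ = 0
      simpa using h)
    rw [MonoidAlgebra.mapDomain_add, MonoidAlgebra.mapDomain_add] at this
    change fieldEval K _ = 0 at this
    simpa [mapDomain_toSemiring] using this
  -- The second null sum, padded by 0, gives f(-(a + b)) = -f(a + b) to substitute in the first.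
  have h1 := key a b (-(a + b)) (by ring)
  have h2 := key (a + b) (-(a + b)) 0 (by ring)
  rw [map_zero, add_zero] at h2
  linear_combination h2 - h1

/-- An involution of a field, considered as a tract, as a ring automorphism. -/
def IsInvolution.ringEquiv {τ : K →*₀ K} (hτ : IsInvolution τ) : K ≃+* K where
  toFun := τ
  invFun := τ
  left_inv := hτ.2
  right_inv := hτ.2
  map_mul' := map_mul τ
  map_add' := hτ.1.map_add

@[simp] theorem IsInvolution.ringEquiv_apply {τ : K →*₀ K} (hτ : IsInvolution τ) (a : K) :
    hτ.ringEquiv a = τ a := rfl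

end Tract

/-! ### The linear space of a Grassmann–Plücker function -/

section Relations

open Tract

variable {K : Type*} [Field K] {E : Type*} {r w : ℕ}

/-- The vectors satisfying all linear relations with coefficients `± ν (y₀, …, ŷ_k, …, y_w)`. -/
def relationSpace (ν : (Fin w → E) → K) : Submodule K (E → K) where
  carrier := {v | ∀ y : Fin (w + 1) → E,
    ∑ k : Fin (w + 1), (-1) ^ (k : ℕ) * ν (y ∘ k.succAbove) * v (y k) = 0}
  zero_mem' := by simp
  add_mem' := by
    intro u v hu hv y
    simp only [Pi.add_apply, mul_add, Finset.sum_add_distrib]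
    rw [hu y, hv y, add_zero]
  smul_mem' := by
    intro c v hv y
    have : ∀ k : Fin (w + 1), (-1) ^ (k : ℕ) * ν (y ∘ k.succAbove) * (c • v) (y k) =
        c * ((-1) ^ (k : ℕ) * ν (y ∘ k.succAbove) * v (y k)) := fun k => by
      simp only [Pi.smul_apply, smul_eq_mul]; ring
    simp only [this, ← Finset.mul_sum, hv y, mul_zero]

theorem mem_relationSpace {ν : (Fin w → E) → K} {v : E → K} :
    v ∈ relationSpace ν ↔ ∀ y : Fin (w + 1) → E,
      ∑ k : Fin (w + 1), (-1) ^ (k : ℕ) * ν (y ∘ k.succAbove) * v (y k) = 0 := Iff.rfl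

theorem relationSpace_eq_of_smul {μ ν : (Fin w → E) → K} {a : K} (ha : a ≠ 0)
    (h : ∀ x, μ x = a * ν x) : relationSpace μ = relationSpace ν := by
  ext v
  rw [mem_relationSpace, mem_relationSpace]
  refine forall_congr' fun y => ?_
  have : ∀ k : Fin (w + 1), (-1) ^ (k : ℕ) * μ (y ∘ k.succAbove) * v (y k) =
      a * ((-1) ^ (k : ℕ) * ν (y ∘ k.succAbove) * v (y k)) := fun k => by rw [h]; ring
  simp only [this, ← Finset.mul_sum, mul_eq_zero, ha, false_or]

/-- A function of tuples which changes sign when two arguments are exchanged and vanishes if two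
arguments are equal. -/
structure IsAlternatingFun (μ : (Fin r → E) → K) : Prop where
  swap : ∀ (x : Fin r → E) (i j : Fin r), i ≠ j → μ (x ∘ Equiv.swap i j) = -μ x
  eq_zero : ∀ (x : Fin r → E) (i j : Fin r), i ≠ j → x i = x j → μ x = 0

theorem GPFunction.isAlternatingFun (φ : GPFunction K E r) : IsAlternatingFun φ.toFun where
  swap x i j h := by simpa using φ.swap x i j h
  eq_zero := φ.eq_zero

/-- The Plücker relations vary only the first argument; this transposition carries any other slot
there. -/
theorem update_comp_swap_eq_cons {m : ℕ} (x : Fin (m + 1) → E) (k : Fin (m + 1)) (e : E) :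
    Function.update x k e ∘ Equiv.swap 0 k =
      (Fin.cons e (Fin.tail (x ∘ Equiv.swap 0 k)) : Fin (m + 1) → E) := by
  funext j
  induction j using Fin.cases with
  | zero => simp
  | succ j =>
    have : Equiv.swap 0 k j.succ ≠ k := by
      intro h
      have h' : Equiv.swap 0 k j.succ = Equiv.swap 0 k 0 := by rw [h, Equiv.swap_apply_left]
      exact Fin.succ_ne_zero j ((Equiv.swap 0 k).injective h')
    simp [Fin.tail, this]

/-- The Plücker flag relations say that `μ`, as a function of any of its arguments, belongs to
the relation space of `ν`. -/
theorem pluckerFlagRelations_iff {ν : (Fin w → E) → K} {μ : (Fin r → E) → K}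
    (hμ : IsAlternatingFun μ) :
    PluckerFlagRelations ν μ ↔
      ∀ (x : Fin r → E) (k : Fin r), (fun e => μ (Function.update x k e)) ∈ relationSpace ν := by
  have key : ∀ (m : ℕ) (hr : r = m + 1) (y : Fin (w + 1) → E) (x : Fin m → E),
      (IsNull fun k : Fin (w + 1) => (eps K : K) ^ ((k : ℕ) + 1) * ν (y ∘ k.succAbove) *
        μ ((Fin.cons (y k) x : Fin (m + 1) → E) ∘ Fin.cast hr)) ↔
      ∑ k : Fin (w + 1), (-1) ^ (k : ℕ) * ν (y ∘ k.succAbove) *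
        μ ((Fin.cons (y k) x : Fin (m + 1) → E) ∘ Fin.cast hr) = 0 := by
    intro m hr y x
    -- The exponents `k + 1` and `k` differ by a global sign only.
    rw [isNull_iff_sum_eq_zero, ← neg_eq_zero, ← Finset.sum_neg_distrib]
    refine Eq.congr (Finset.sum_congr rfl fun k _ => ?_) rfl
    rw [coe_eps_field]
    ring
  constructor
  · intro h x k
    obtain _ | m := r
    · exact k.elim0
    have h0 : (fun e => μ (Fin.cons e (Fin.tail (x ∘ Equiv.swap 0 k)) : Fin (m + 1) → E)) ∈
        relationSpace ν := fun y => (key m rfl y _).1 (h m rfl y _)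
    simp only [← update_comp_swap_eq_cons] at h0
    by_cases hk : 0 = k
    · subst hk
      simpa using h0
    · have : (fun e => μ (Function.update x k e)) =
          -fun e => μ (Function.update x k e ∘ Equiv.swap 0 k) := by
        funext e
        simp [hμ.swap _ _ _ hk]
      rw [this]
      exact neg_mem h0
  · rintro h m rfl y x
    rw [key]
    -- The entry `e₀` is only a filler for slot 0, which the update overwrites.
    rcases isEmpty_or_nonempty E with hE | ⟨⟨e₀⟩⟩
    · exact hE.elim (y 0)
    · simpa using h (Fin.cons e₀ x) 0 y

/-! ### Restriction to a basis -/

/-- A vector satisfying the relations between a basis `b` and one further element is determined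
by its restriction to `b`. -/
theorem eq_zero_of_relations {ν : (Fin w → E) → K} {b : Fin w → E} (hb : ν b ≠ 0) {v : E → K}
    (hv : ∀ e ∉ Set.range b, ∑ k : Fin (w + 1), (-1) ^ (k : ℕ) *
      ν ((Fin.cons e b : Fin (w + 1) → E) ∘ k.succAbove) *
      v ((Fin.cons e b : Fin (w + 1) → E) k) = 0)
    (h0 : ∀ i, v (b i) = 0) : v = 0 := by
  funext e
  by_cases he : e ∈ Set.range b
  · obtain ⟨i, rfl⟩ := he
    exact h0 i
  · have h := hv e he
    rw [Fin.sum_univ_succ] at h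
    have hcomp : (Fin.cons e b : Fin (w + 1) → E) ∘ Fin.succ = b := by
      funext j; simp
    simpa [h0, hcomp, hb] using h

theorem eq_zero_of_mem_relationSpace {ν : (Fin w → E) → K} {b : Fin w → E} (hb : ν b ≠ 0)
    {v : E → K} (hv : v ∈ relationSpace ν) (h0 : ∀ i, v (b i) = 0) : v = 0 :=
  eq_zero_of_relations hb (fun _ _ => hv _) h0

theorem IsAlternatingFun.update_apply_of_ne {μ : (Fin r → E) → K} (hμ : IsAlternatingFun μ)
    (b : Fin r → E) {i j : Fin r} (hij : j ≠ i) : μ (Function.update b i (b j)) = 0 :=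
  hμ.eq_zero _ i j hij.symm (by simp [hij])

/-- The combination of the functions `e ↦ μ (b₁, …, e, …, b_r)` with prescribed restriction
to the basis `b`. -/
def interpolate (μ : (Fin r → E) → K) (b : Fin r → E) (c : Fin r → K) : E → K :=
  ∑ i, (c i / μ b) • fun e => μ (Function.update b i e)

theorem interpolate_apply {μ : (Fin r → E) → K} (hμ : IsAlternatingFun μ) {b : Fin r → E}
    (hb : μ b ≠ 0) (c : Fin r → K) (j : Fin r) : interpolate μ b c (b j) = c j := by
  rw [interpolate, Finset.sum_apply, Finset.sum_eq_single j]
  · simp [hb]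
  · intro i _ hij
    simp [hμ.update_apply_of_ne b hij.symm]
  · simp

namespace GPFunction

theorem update_mem_relationSpace (φ : GPFunction K E r) (x : Fin r → E) (k : Fin r) :
    (fun e => φ.toFun (Function.update x k e)) ∈ relationSpace φ.toFun :=
  (pluckerFlagRelations_iff φ.isAlternatingFun).1 φ.plucker x k

theorem interpolate_mem (φ : GPFunction K E r) (b : Fin r → E) (c : Fin r → K) :
    interpolate φ.toFun b c ∈ relationSpace φ.toFun :=
  Submodule.sum_mem _ fun i _ => Submodule.smul_mem _ _ (φ.update_mem_relationSpace b i)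

/-- The relations between one basis and one further element already imply all others: v and its
interpolant agree on b and both satisfy these relations, so they coincide. This is why fundamental
circuits of a single basis suffice to detect covectors. -/
theorem mem_relationSpace_of_relations (φ : GPFunction K E r) {b : Fin r → E}
    (hb : φ.toFun b ≠ 0) {v : E → K}
    (hv : ∀ e ∉ Set.range b, ∑ k : Fin (r + 1), (-1) ^ (k : ℕ) *
      φ.toFun ((Fin.cons e b : Fin (r + 1) → E) ∘ k.succAbove) *
      v ((Fin.cons e b : Fin (r + 1) → E) k) = 0) : v ∈ relationSpace φ.toFun := by
  set u := interpolate φ.toFun b (v ∘ b) with hu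
  have hmem : u ∈ relationSpace φ.toFun := φ.interpolate_mem b _
  have : v - u = 0 := by
    refine eq_zero_of_relations hb (fun e he => ?_) fun i => ?_
    · simp only [Pi.sub_apply, mul_sub, Finset.sum_sub_distrib]
      rw [hv e he, mem_relationSpace.1 hmem, sub_zero]
    · simp [hu, interpolate_apply φ.isAlternatingFun hb]
  rwa [sub_eq_zero.1 this]

theorem relationSpace_eq_span (φ : GPFunction K E r) :
    relationSpace φ.toFun =
      Submodule.span K {v | ∃ x k, v = fun e => φ.toFun (Function.update x k e)} := by
  refine le_antisymm (fun v hv => ?_) (Submodule.span_le.2 ?_)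
  · obtain ⟨b, hb⟩ := φ.exists_ne_zero
    have : v - interpolate φ.toFun b (v ∘ b) = 0 := by
      refine eq_zero_of_mem_relationSpace hb (sub_mem hv (φ.interpolate_mem b _)) fun i => ?_
      simp [interpolate_apply φ.isAlternatingFun hb]
    rw [sub_eq_zero.1 this]
    exact Submodule.sum_mem _ fun i _ => Submodule.smul_mem _ _
      (Submodule.subset_span ⟨b, i, rfl⟩)
  · rintro _ ⟨x, k, rfl⟩
    exact φ.update_mem_relationSpace x k

theorem pluckerFlagRelations_iff_le (φ : GPFunction K E r) (ψ : GPFunction K E w) :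
    PluckerFlagRelations ψ.toFun φ.toFun ↔ relationSpace φ.toFun ≤ relationSpace ψ.toFun := by
  rw [pluckerFlagRelations_iff φ.isAlternatingFun, φ.relationSpace_eq_span, Submodule.span_le]
  constructor
  · rintro h _ ⟨x, k, rfl⟩
    exact h x k
  · exact fun h x k => h ⟨x, k, rfl⟩

theorem finrank_relationSpace (φ : GPFunction K E r) :
    Module.finrank K (relationSpace φ.toFun) = r := by
  obtain ⟨b, hb⟩ := φ.exists_ne_zero
  let f : relationSpace φ.toFun →ₗ[K] (Fin r → K) :=
    (LinearMap.funLeft K K b).comp (relationSpace φ.toFun).subtype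
  have hf : Function.Bijective f := by
    refine ⟨(injective_iff_map_eq_zero f).2 fun v hv => Subtype.ext ?_, fun c => ?_⟩
    · exact eq_zero_of_mem_relationSpace hb v.2 fun i => congrFun hv i
    · exact ⟨⟨_, φ.interpolate_mem b c⟩,
        funext fun j => interpolate_apply φ.isAlternatingFun hb c j⟩
  rw [(LinearEquiv.ofBijective f hf).finrank_eq, Module.finrank_fin_fun]

end GPFunction

/-! ### Uniqueness -/

theorem IsAlternatingFun.comp_eq_zero {δ : (Fin r → E) → K} (hδ : IsAlternatingFun δ)
    {b : Fin r → E} (hb : δ b = 0) (f : Fin r → Fin r) : δ (b ∘ f) = 0 := by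
  by_cases hf : Function.Injective f
  · have hperm : ∀ σ : Equiv.Perm (Fin r), δ (b ∘ σ) = 0 := by
      intro σ
      induction σ using Equiv.Perm.swap_induction_on' with
      | one => exact hb
      | mul_swap σ i j hij ih =>
        have := hδ.swap (b ∘ σ) i j hij
        rwa [ih, neg_zero] at this
    exact hperm (Equiv.ofBijective f (Finite.injective_iff_bijective.1 hf))
  · rw [Function.Injective] at hf
    push Not at hf
    obtain ⟨i, j, hij, hne⟩ := hf
    exact hδ.eq_zero _ i j hne (congrArg b hij)

/-- An alternating function all of whose partial functions belong to a space of vectors determined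
by their restriction to `b` vanishes if it vanishes at `b`. -/
theorem IsAlternatingFun.eq_zero_of_update_mem {δ : (Fin r → E) → K} (hδ : IsAlternatingFun δ)
    {b : Fin r → E} (hb : δ b = 0) {V : Submodule K (E → K)}
    (hV : ∀ v ∈ V, (∀ i, v (b i) = 0) → v = 0)
    (hmem : ∀ x k, (fun e => δ (Function.update x k e)) ∈ V) (x : Fin r → E) : δ x = 0 := by
  -- Only the first n entries of x are free; the others lie in b. Freeing one more entry gives a
  -- slice in V that vanishes on b by induction, hence vanishes.
  have key : ∀ n ≤ r, ∀ x : Fin r → E, (∀ j : Fin r, n ≤ j → x j ∈ Set.range b) → δ x = 0 := by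
    intro n
    induction n with
    | zero =>
      intro _ x hx
      choose f hf using fun j => hx j (Nat.zero_le _)
      rw [← funext hf]
      exact hδ.comp_eq_zero hb f
    | succ n ih =>
      intro hn x hx
      have := hV _ (hmem x ⟨n, hn⟩) fun i => ih (Nat.le_of_succ_le hn) _ fun j hj => by
        by_cases hjn : j = ⟨n, hn⟩
        · simp [hjn]
        · rw [Function.update_of_ne hjn]
          refine hx j (lt_of_le_of_ne hj fun h => hjn (Fin.ext h.symm))
      simpa using congrFun this (x ⟨n, hn⟩)
  exact key r le_rfl x fun j hj => absurd j.2 (not_lt.2 hj)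

/-- The function x ↦ φ(x) ψ(b) - φ(b) ψ(x) is alternating, vanishes at b, and has all its slices in
the common space, so it is zero. -/
theorem GPFunction.equiv_of_relationSpace_eq {φ ψ : GPFunction K E r}
    (h : relationSpace φ.toFun = relationSpace ψ.toFun) :
    ∃ a : Kˣ, ∀ x, φ.toFun x = a * ψ.toFun x := by
  obtain ⟨b, hb⟩ := φ.exists_ne_zero
  have key : ∀ x, φ.toFun x * ψ.toFun b - φ.toFun b * ψ.toFun x = 0 := by
    refine IsAlternatingFun.eq_zero_of_update_mem (V := relationSpace φ.toFun)
      ⟨fun x i j hij => ?_, fun x i j hij hx => ?_⟩ (by ring)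
      (fun v hv => eq_zero_of_mem_relationSpace hb hv) fun x k => ?_
    · rw [φ.isAlternatingFun.swap x i j hij, ψ.isAlternatingFun.swap x i j hij]
      ring
    · rw [φ.eq_zero x i j hij hx, ψ.eq_zero x i j hij hx]
      ring
    · have hφ := (relationSpace φ.toFun).smul_mem (ψ.toFun b) (φ.update_mem_relationSpace x k)
      have hψ := (relationSpace φ.toFun).smul_mem (φ.toFun b)
        (h ▸ ψ.update_mem_relationSpace x k)
      convert sub_mem hφ hψ using 1
      funext e
      simp [mul_comm]
  obtain ⟨z, hz⟩ := ψ.exists_ne_zero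
  have hψb : ψ.toFun b ≠ 0 := by
    intro h0
    have := key z
    simp [h0, hb, hz] at this
  refine ⟨Units.mk0 (φ.toFun b / ψ.toFun b) (div_ne_zero hb hψb), fun x => ?_⟩
  rw [Units.val_mk0]
  field_simp
  linear_combination key x

/-! ### The Grassmann–Plücker function of a linear space -/

/-- The determinant of the vectors `v i`, restricted to a tuple. -/
def minor (v : Fin r → E → K) (x : Fin r → E) : K :=
  (Matrix.of fun i j => v i (x j)).det

theorem isAlternatingFun_minor (v : Fin r → E → K) : IsAlternatingFun (minor v) where
  swap x i j hij := by
    have := Matrix.det_permute' (Equiv.swap i j) (Matrix.of fun i j => v i (x j))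
    rw [Equiv.Perm.sign_swap hij] at this
    rw [Units.val_neg, Units.val_one, Int.cast_neg, Int.cast_one, neg_one_mul] at this
    exact this
  eq_zero x i j hij hx :=
    Matrix.det_zero_of_column_eq hij fun k => by simp [hx]

/-- By Cramer's rule, a determinant is linear in its k-th column, with coefficients from the
adjugate that do not depend on e. -/
theorem minor_update_mem (v : Fin r → E → K) (x : Fin r → E) (k : Fin r) :
    (fun e => minor v (Function.update x k e)) ∈ Submodule.span K (Set.range v) := by
  have : (fun e => minor v (Function.update x k e)) =
      ∑ i, (Matrix.of fun i j => v i (x j)).adjugate k i • v i := by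
    funext e
    have h := congrFun (Matrix.cramer_eq_adjugate_mulVec
      (Matrix.of fun i j => v i (x j)) (fun i => v i e)) k
    rw [Matrix.cramer_apply] at h
    rw [Finset.sum_apply]
    refine Eq.trans ?_ h
    unfold minor
    congr 1
    ext i j
    by_cases hj : j = k
    · subst hj; simp
    · simp [hj]
  rw [this]
  exact Submodule.sum_mem _ fun i _ =>
    Submodule.smul_mem _ _ (Submodule.subset_span ⟨i, rfl⟩)

/-- Put `v i` as an extra row on top of the matrix: the determinant has a repeated row, and its
Laplace expansion along the top row is the required relation. -/
theorem span_le_relationSpace_minor (v : Fin r → E → K) :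
    Submodule.span K (Set.range v) ≤ relationSpace (minor v) := by
  rw [Submodule.span_le]
  rintro _ ⟨i, rfl⟩ y
  let A : Matrix (Fin (r + 1)) (Fin (r + 1)) K :=
    Matrix.of fun k j => (Fin.cons (v i) v : Fin (r + 1) → E → K) k (y j)
  have hA : A.det = 0 := Matrix.det_zero_of_row_eq (Fin.succ_ne_zero i).symm (by
    funext j; simp [A])
  rw [Matrix.det_succ_row_zero] at hA
  rw [← hA]
  refine Finset.sum_congr rfl fun k _ => ?_
  have : minor v (y ∘ k.succAbove) = (A.submatrix Fin.succ k.succAbove).det := by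
    unfold minor
    congr 1
  rw [this]
  simp only [A, Matrix.of_apply, Fin.cons_zero]
  ring

/-- Row rank equals column rank, so r of the columns form a basis of K^r; their indices give x. -/
theorem exists_minor_ne_zero [Fintype E] {v : Fin r → E → K} (hv : LinearIndependent K v) :
    ∃ x, minor v x ≠ 0 := by
  let A : Matrix (Fin r) E K := Matrix.of v
  have hrank : A.rank = r := by
    simpa using LinearIndependent.rank_matrix (M := A) hv
  have hspan : Submodule.span K (Set.range A.col) = ⊤ := by
    apply Submodule.eq_top_of_finrank_eq
    rw [← Matrix.rank_eq_finrank_span_cols, hrank, Module.finrank_fin_fun]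
  obtain ⟨s, hs, hspan', hli⟩ := exists_linearIndependent K (Set.range A.col)
  rw [hspan] at hspan'
  let B : Module.Basis s K (Fin r → K) := Module.Basis.mk hli (by simp [hspan'])
  let e : s ≃ Fin r := B.indexEquiv (Pi.basisFun K (Fin r))
  choose f hf using fun j : Fin r => hs (e.symm j).2
  refine ⟨f, ?_⟩
  have hli' : LinearIndependent K fun j => ((e.symm j : s) : Fin r → K) :=
    hli.comp _ e.symm.injective
  have hunit : IsUnit (A.submatrix id f) := by
    rw [← Matrix.linearIndependent_cols_iff_isUnit]
    convert hli' using 1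
    funext j
    rw [← hf j]
    rfl
  exact ((Matrix.isUnit_iff_isUnit_det _).1 hunit).ne_zero

/-- For the minors of a basis of V, the slices lie in V and V lies in the relation space. This
yields the Plücker relations; equality then follows by dimension. -/
theorem exists_gpFunction_relationSpace_eq [Fintype E] {V : Submodule K (E → K)}
    (hV : Module.finrank K V = r) : ∃ φ : GPFunction K E r, relationSpace φ.toFun = V := by
  let B : Module.Basis (Fin r) K V := Module.finBasisOfFinrankEq K V hV
  let v : Fin r → E → K := fun i => B i
  have hli : LinearIndependent K v :=
    B.linearIndependent.map' V.subtype (Submodule.ker_subtype V)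
  have hspan : Submodule.span K (Set.range v) = V := by
    have h := congrArg (Submodule.map V.subtype) B.span_eq
    rwa [Submodule.map_span, Submodule.map_top, Submodule.range_subtype, ← Set.range_comp] at h
  have halt := isAlternatingFun_minor v
  refine ⟨⟨minor v, exists_minor_ne_zero hli, fun x i j hij => ?_, halt.eq_zero,
    (pluckerFlagRelations_iff halt).2 fun x k =>
      span_le_relationSpace_minor v (minor_update_mem v x k)⟩, ?_⟩
  · simpa using halt.swap x i j hij
  · refine (Submodule.eq_of_le_of_finrank_eq (hspan ▸ span_le_relationSpace_minor v) ?_).symm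
    rw [hV, GPFunction.finrank_relationSpace]

end Relations

/-! ### Twisting linear spaces by a field automorphism -/

section Twist

variable {K : Type*} [Field K] {E : Type*}

/-- The linear space of all vectors whose entrywise image under `σ` belongs to `V`. -/
def Submodule.twist (σ : K ≃+* K) (V : Submodule K (E → K)) : Submodule K (E → K) where
  carrier := {X | σ ∘ X ∈ V}
  zero_mem' := by
    have : σ ∘ (0 : E → K) = 0 := by funext e; simp
    rw [Set.mem_ofPred_eq, this]
    exact V.zero_mem
  add_mem' {X Y} hX hY := by
    have : σ ∘ (X + Y) = σ ∘ X + σ ∘ Y := by funext e; simp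
    rw [Set.mem_ofPred_eq, this]
    exact V.add_mem hX hY
  smul_mem' c X hX := by
    have : σ ∘ (c • X) = σ c • (σ ∘ X) := by funext e; simp
    rw [Set.mem_ofPred_eq, this]
    exact V.smul_mem _ hX

theorem Submodule.mem_twist {σ : K ≃+* K} {V : Submodule K (E → K)} {X : E → K} :
    X ∈ V.twist σ ↔ σ ∘ X ∈ V := Iff.rfl

theorem Submodule.twist_mono (σ : K ≃+* K) {V W : Submodule K (E → K)} (h : V ≤ W) :
    V.twist σ ≤ W.twist σ := fun _ hX => h hX

@[simp] theorem Submodule.twist_symm_twist (σ : K ≃+* K) (V : Submodule K (E → K)) :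
    (V.twist σ.symm).twist σ = V := by
  ext X
  have : σ.symm ∘ (σ ∘ X) = X := by funext e; simp
  rw [mem_twist, mem_twist, this]

@[simp] theorem Submodule.twist_twist_symm (σ : K ≃+* K) (V : Submodule K (E → K)) :
    (V.twist σ).twist σ.symm = V :=
  V.twist_symm_twist σ.symm

theorem Submodule.finrank_twist (σ : K ≃+* K) (V : Submodule K (E → K)) :
    Module.finrank K (V.twist σ) = Module.finrank K V := by
  let j : V.twist σ ≃+ V :=
    { toFun := fun X => ⟨σ ∘ X.1, X.2⟩
      invFun := fun X => ⟨σ.symm ∘ X.1, by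
        have : σ ∘ (σ.symm ∘ X.1) = X.1 := by funext e; simp
        rw [mem_twist, this]
        exact X.2⟩
      left_inv := fun X => by ext e; simp
      right_inv := fun X => by ext e; simp
      map_add' := fun X Y => by ext e; simp }
  -- The map `j` is only σ-semilinear, so the ranks are compared along the pair (σ, `j`).
  exact congrArg Cardinal.toNat
    (rank_eq_of_equiv_equiv σ j σ.bijective fun c X => by ext e; simp [j])

end Twist

/-! ### Covectors -/

section Covectors

open Tract

variable {K : Type*} [Field K] {E : Type*} {r : ℕ}

theorem GPFunction.sum_circuitVector [Fintype E] (φ : GPFunction K E r) {y : Fin (r + 1) → E}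
    (hy : Function.Injective y) (v : E → K) :
    ∑ e, φ.circuitVector y e * v e =
      ∑ k : Fin (r + 1), (-1) ^ (k : ℕ) * φ.toFun (y ∘ k.succAbove) * v (y k) := by
  symm
  refine Fintype.sum_of_injective y hy _ _ (fun e he => ?_) fun k => ?_
  · rw [circuitVector, Function.extend_apply' _ _ _ he, Pi.zero_apply, zero_mul]
  · rw [circuitVector, hy.extend_apply, coe_eps_field]

theorem GPFunction.isBase_underlying [Finite E] (φ : GPFunction K E r) {x : Fin r → E}
    (hx : φ.toFun x ≠ 0) : φ.underlying.IsBase (Set.range x) :=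
  ⟨x, hx, rfl⟩

/-- Applying τ to the equation moves the twist from Y to X, since τ² = id. -/
theorem orthogonal_iff [Fintype E] {τ : K →*₀ K} (hτ : IsInvolution τ) (X Y : E → K) :
    Orthogonal τ X Y ↔ ∑ e, Y e * τ (X e) = 0 := by
  rw [Orthogonal, isNull_iff_sum_eq_zero, ← map_eq_zero_iff _ hτ.ringEquiv.injective, map_sum]
  refine Eq.congr (Finset.sum_congr rfl fun e _ => ?_) rfl
  rw [IsInvolution.ringEquiv_apply, map_mul, hτ.2, mul_comm]

theorem GPFunction.orthogonal_circuits_iff [Fintype E] {τ : K →*₀ K} (hτ : IsInvolution τ)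
    (φ : GPFunction K E r) (X : E → K) :
    (∀ Y ∈ φ.circuits, Orthogonal τ X Y) ↔ τ ∘ X ∈ relationSpace φ.toFun := by
  constructor
  · intro h
    obtain ⟨b, hb⟩ := φ.exists_ne_zero
    refine φ.mem_relationSpace_of_relations hb fun e he => ?_
    have hinj : Function.Injective (Fin.cons e b : Fin (r + 1) → E) :=
      Fin.cons_injective_iff.2 ⟨he, φ.injective_of_ne_zero hb⟩
    have hbase := φ.isBase_underlying hb
    -- Testing against the fundamental circuit of e and b gives the relation for (e, b).
    have horth := h (φ.circuitVector (Fin.cons e b : Fin (r + 1) → E))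
      ⟨φ.underlying.fundCircuit e (Set.range b), Fin.cons e b, 1,
        hbase.fundCircuit_isCircuit (Set.mem_univ e) he,
        by simpa using φ.underlying.mem_fundCircuit e _, by simpa using hb,
        by simpa [Set.sdiff_subset_iff] using φ.underlying.fundCircuit_subset_insert e _,
        by simp⟩
    rwa [orthogonal_iff hτ, φ.sum_circuitVector hinj fun e => τ (X e)] at horth
  · rintro hX _ ⟨C, y, a, hC, hyC, hy, hCy, rfl⟩
    have hinj : Function.Injective y := by
      rw [← Fin.cons_self_tail y, Fin.cons_injective_iff]
      -- If y₀ were among y₁, …, y_r, the circuit C would lie inside a basis.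
      refine ⟨fun hmem => hC.not_indep ?_, φ.injective_of_ne_zero hy⟩
      refine (φ.isBase_underlying hy).indep.subset fun e he => ?_
      by_cases h : e = y 0
      · rwa [h]
      · exact hCy ⟨he, h⟩
    rw [orthogonal_iff hτ]
    simp only [mul_assoc, ← Finset.mul_sum]
    rw [φ.sum_circuitVector hinj fun e => τ (X e)]
    exact mul_eq_zero_of_right _ (hX y)

namespace FMatroid

theorem represents_iff {φ ψ : GPFunction K E r} :
    Represents φ (Quotient.mk (GPFunction.setoid K E r) ψ) ↔
      relationSpace φ.toFun = relationSpace ψ.toFun := by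
  constructor
  · intro h
    obtain ⟨a, ha⟩ := Quotient.exact h
    exact relationSpace_eq_of_smul a.ne_zero ha
  · exact fun h => Quotient.sound (GPFunction.equiv_of_relationSpace_eq h)

/-- The linear space of the Grassmann–Plücker functions representing a matroid over a field. -/
noncomputable def linearSpace (M : FMatroid K E r) : Submodule K (E → K) :=
  Quotient.lift (fun φ : GPFunction K E r => relationSpace φ.toFun)
    (fun φ ψ (h : ∃ a : Kˣ, ∀ x, φ.toFun x = a * ψ.toFun x) =>
      let ⟨a, ha⟩ := h
      relationSpace_eq_of_smul a.ne_zero ha) M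

theorem Represents.linearSpace_eq {φ : GPFunction K E r} {M : FMatroid K E r}
    (h : Represents φ M) : M.linearSpace = relationSpace φ.toFun := by
  rw [← h]
  rfl

theorem exists_represents (M : FMatroid K E r) : ∃ φ, Represents φ M :=
  Quotient.exists_rep M

theorem linearSpace_injective :
    Function.Injective (linearSpace : FMatroid K E r → Submodule K (E → K)) := by
  intro M N h
  obtain ⟨φ, rfl⟩ := M.exists_represents
  obtain ⟨ψ, rfl⟩ := N.exists_represents
  exact represents_iff.2 h

theorem finrank_linearSpace (M : FMatroid K E r) : Module.finrank K M.linearSpace = r := by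
  obtain ⟨φ, hφ⟩ := M.exists_represents
  rw [hφ.linearSpace_eq, φ.finrank_relationSpace]

theorem exists_linearSpace_eq [Fintype E] {V : Submodule K (E → K)}
    (hV : Module.finrank K V = r) : ∃ M : FMatroid K E r, M.linearSpace = V := by
  obtain ⟨φ, hφ⟩ := exists_gpFunction_relationSpace_eq hV
  exact ⟨Quotient.mk _ φ, hφ⟩

theorem isQuotientOf_iff {w : ℕ} (M : FMatroid K E r) (N : FMatroid K E w) :
    M.IsQuotientOf N ↔ M.linearSpace ≤ N.linearSpace := by
  constructor
  · intro h
    obtain ⟨φ, hφ⟩ := M.exists_represents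
    obtain ⟨ψ, hψ⟩ := N.exists_represents
    rw [hφ.linearSpace_eq, hψ.linearSpace_eq]
    exact (φ.pluckerFlagRelations_iff_le ψ).1 (h φ ψ hφ hψ)
  · intro h φ ψ hφ hψ
    rw [hφ.linearSpace_eq, hψ.linearSpace_eq] at h
    exact (φ.pluckerFlagRelations_iff_le ψ).2 h

theorem covectors_eq_twist [Fintype E] {τ : K →*₀ K} (hτ : IsInvolution τ)
    (M : FMatroid K E r) :
    M.covectors τ = (M.linearSpace.twist hτ.ringEquiv : Set (E → K)) := by
  ext X
  rw [SetLike.mem_coe, Submodule.mem_twist]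
  constructor
  · intro h
    obtain ⟨φ, hφ⟩ := M.exists_represents
    rw [hφ.linearSpace_eq]
    exact (φ.orthogonal_circuits_iff hτ X).1 fun Y hY => h Y ⟨φ, hφ, hY⟩
  · rintro h Y ⟨φ, hφ, hY⟩
    rw [hφ.linearSpace_eq] at h
    exact (φ.orthogonal_circuits_iff hτ X).2 h Y hY

end FMatroid

namespace FlagMatroid

variable {s : ℕ} {r : Fin s → ℕ}

theorem linearSpace_mono (M : FlagMatroid K E r) : Monotone fun i => (M.1 i).linearSpace := by
  intro i j hij
  rcases hij.eq_or_lt with rfl | hlt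
  · exact le_rfl
  · exact (FMatroid.isQuotientOf_iff _ _).1 (M.2 i j hlt)

/-- The flag of covector spaces of a flag matroid over a field. -/
noncomputable def covectorFlag {τ : K →*₀ K} (hτ : IsInvolution τ) (M : FlagMatroid K E r) :
    LinearFlag K E r :=
  ⟨fun i => (M.1 i).linearSpace.twist hτ.ringEquiv,
    fun _ _ hij => Submodule.twist_mono _ (M.linearSpace_mono hij),
    fun i => by rw [Submodule.finrank_twist, FMatroid.finrank_linearSpace]⟩

theorem covectorFlag_bijective [Fintype E] {τ : K →*₀ K} (hτ : IsInvolution τ) :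
    Function.Bijective (covectorFlag hτ : FlagMatroid K E r → LinearFlag K E r) := by
  constructor
  · intro M N h
    refine Subtype.ext (funext fun i => FMatroid.linearSpace_injective ?_)
    have hi : (M.1 i).linearSpace.twist hτ.ringEquiv = (N.1 i).linearSpace.twist hτ.ringEquiv :=
      congrFun (congrArg Subtype.val h) i
    simpa using congrArg (Submodule.twist hτ.ringEquiv.symm) hi
  · rintro ⟨V, hmono, hrank⟩
    -- The covector space is the twist of the linear space, so the preimage of V has the inversely
    -- twisted spaces as its linear spaces.
    choose M hM using fun i => FMatroid.exists_linearSpace_eq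
      ((Submodule.finrank_twist hτ.ringEquiv.symm (V i)).trans (hrank i))
    refine ⟨⟨M, fun i j hij => ?_⟩, Subtype.ext (funext fun i => ?_)⟩
    · rw [FMatroid.isQuotientOf_iff, hM, hM]
      exact Submodule.twist_mono _ (hmono hij.le)
    · simp [covectorFlag, hM]

end FlagMatroid

end Covectors

theorem proposition2p18 {K : Type*} [Field K] (τ : K →*₀ K) (hτ : Tract.IsInvolution τ)
    {E : Type*} [Fintype E] {s : ℕ} (r : Fin s → ℕ) :
    (∀ (M : FlagMatroid K E r) (i j : Fin s), i ≤ j →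
      (M.1 i).covectors τ ⊆ (M.1 j).covectors τ) ∧
    ∃ Φ : FlagMatroid K E r → LinearFlag K E r,
      (∀ (M : FlagMatroid K E r) (i : Fin s),
        ((Φ M).1 i : Set (E → K)) = (M.1 i).covectors τ) ∧
      Function.Bijective Φ := by
  refine ⟨fun M i j hij => ?_, FlagMatroid.covectorFlag hτ,
    fun M i => ((M.1 i).covectors_eq_twist hτ).symm, FlagMatroid.covectorFlag_bijective hτ⟩
  rw [FMatroid.covectors_eq_twist hτ, FMatroid.covectors_eq_twist hτ]
  exact Submodule.twist_mono _ (M.linearSpace_mono hij)
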